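/- All Banach algebras are complex, with submultiplicative norm and, when unital, with unit $1$ of norm $\|1\|=1$. For a unital Banach algebra $A$, let $A^{-1}$ denote the group of invertible elements of $A$, equipped with the metric $d(f,g)=\|f-g\|$; an algebra is called semisimple if its Jacobson radical is $\{0\}$. Theorem. Let $A$ be a unital semisimple commutative Banach algebra and let $B$ be a unital Banach algebra. Let $\mathfrak A$ and $\mathfrak B$ be open subgroups of $A^{-1}$ and $B^{-1}$ respectively, and let $T:\mathfrak A\to\mathfrak B$ be a surjective isometry of metric spaces, i.e. $T(\mathfrak A)=\mathfrak B$ and $\|T(f)-T(g)\|=\|f-g\|$ for all $f,g\in\mathfrak A$. Then $B$ is semisimple and commutative, and there is an isomorphism $\Phi:A\to B$ of real algebras which is isometric and satisfies $\Phi(f)=T(1)^{-1}T(f)$ for every $f\in\mathfrak A$. In particular, $A^{-1}$ and $B^{-1}$ are isometrically isomorphic as metrizable groups, i.e. there is a group isomorphism $\Psi:A^{-1}\to B^{-1}$ with $\|\Psi(u)-\Psi(v)\|=\|u-v\|$ for all $u,v\in A^{-1}$. -/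

import Mathlib

/-- A ring is semisimple in the sense of Banach algebra theory if its Jacobson radical is zero.
(This is not the Artinian notion `IsSemisimpleRing`.) -/
def JacobsonSemisimple (R : Type*) [Ring R] : Prop :=
  Ring.jacobson R = ⊥

/-! A local Mazur–Ulam theorem makes `T` real affine on each convex cone spanned by a unit ball
around `c • 1`, `|c| = 1`; these cones lie in the open group. The cones at `1, I, -1, -I` overlap
cyclically, so one affine map `S + u` serves all four, and together they contain `c • 1 + f`
whenever `|c| > 4‖f‖`. Comparing an arbitrary `f` of the group with these far points, a Cauchy
estimate (`eq_zero_of_norm_sub_le`) forces `T f = S f + u`. If `u ≠ 0`, the group would be invariant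
under a nonzero translation, which semisimplicity forbids.

It remains to see that `S` is multiplicative up to `S 1`. For a character `φ` of `A`, the real
functional `φ ∘ S⁻¹` vanishes at no exponential, so a real-linear Gleason–Kahane–Żelazko theorem
writes it as `l ∘ χ` with `χ` a character of `B`. Here `l` is an isometry of `ℂ`, hence a rotation,
possibly after conjugation. So `b ↦ S⁻¹ (S 1 * b)` is multiplicative under every `φ`, and therefore
multiplicative. Its inverse is the required isomorphism, along which commutativity and
semisimplicity pass to `B`. -/

open Set Filter Topology NormedSpace

/-! ### Local Mazur–Ulam theorem by reflections -/

/-- An isometry of a bounded space carrying a reflection in `m` fixes `m`. -/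
theorem IsometryEquiv.fixed_of_reflection {V : Type*} [MetricSpace V] {C : ℝ}
    (hC : ∀ x y : V, dist x y ≤ C) (σ : V ≃ᵢ V) (m : V)
    (hσ : ∀ x, dist (σ x) x = 2 * dist x m) (e : V ≃ᵢ V) : e m = m := by
  have hm : σ m = m := by simpa using hσ m
  -- The word `σ e⁻¹ σ e` moves `m` twice as far as `e` does, so the finite supremum of
  -- displacements of `m` must be zero.
  let f : V ≃ᵢ V → V ≃ᵢ V := fun e => ((e.trans σ).trans e.symm).trans σ
  have hf : ∀ e, dist (f e m) m = 2 * dist (e m) m := by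
    intro e
    calc dist (f e m) m = dist (σ (e.symm (σ (e m)))) (σ m) := by rw [hm]; rfl
      _ = dist (σ (e m)) (e m) := by
        rw [σ.dist_eq, ← e.dist_eq, e.apply_symm_apply]
      _ = _ := hσ _
  have hb : BddAbove (range fun e : V ≃ᵢ V => dist (e m) m) :=
    ⟨C, forall_mem_range.2 fun e => hC _ _⟩
  have : Nonempty (V ≃ᵢ V) := ⟨e⟩
  have h1 : (⨆ e : V ≃ᵢ V, dist (e m) m) ≤ (⨆ e : V ≃ᵢ V, dist (e m) m) / 2 := by
    refine ciSup_le fun e => ?_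
    rw [le_div_iff₀' (zero_lt_two' ℝ), ← hf]
    exact le_ciSup hb (f e)
  have h2 := le_ciSup hb e
  exact dist_le_zero.1 (by linarith)

/-- The conjugate `e⁻¹ τ e` fixes `m`, so `τ` fixes `e m`; by `hτ` its only fixed point is `n`. -/
theorem IsometryEquiv.map_center_of_reflection {V W : Type*} [MetricSpace V] [MetricSpace W]
    {C : ℝ} (hC : ∀ x y : V, dist x y ≤ C) (σ : V ≃ᵢ V) (m : V)
    (hσ : ∀ x, dist (σ x) x = 2 * dist x m) (τ : W ≃ᵢ W) (n : W)
    (hτ : ∀ x, dist (τ x) x = 2 * dist x n) (e : V ≃ᵢ W) : e m = n := by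
  have h := IsometryEquiv.fixed_of_reflection hC σ m hσ ((e.trans τ).trans e.symm)
  have h1 : τ (e m) = e m := by
    have h' : e.symm (τ (e m)) = m := h
    rw [← e.apply_symm_apply (τ (e m)), h']
  have h2 := hτ (e m)
  rw [h1, dist_self] at h2
  exact dist_le_zero.1 (by linarith)

/-- The points at distance `dist a b / 2` from both `a` and `b`. -/
def midSet {E : Type*} [PseudoMetricSpace E] (a b : E) : Set E :=
  {x | dist x a = dist a b / 2 ∧ dist x b = dist a b / 2}

section MidSet

variable {E : Type*} [NormedAddCommGroup E] [NormedSpace ℝ E]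

theorem midpoint_mem_midSet (a b : E) : midpoint ℝ a b ∈ midSet a b := by
  constructor
  · rw [dist_midpoint_left]; simp; ring
  · rw [dist_midpoint_right]; simp; ring

theorem sub_mem_midSet {E : Type*} [NormedAddCommGroup E] {a b x : E} (hx : x ∈ midSet a b) : a + b - x ∈ midSet a b := by
  obtain ⟨h1, h2⟩ := hx
  constructor
  · rw [← h2, dist_eq_norm, dist_eq_norm, ← norm_neg]; congr 1; abel
  · rw [← h1, dist_eq_norm, dist_eq_norm, ← norm_neg]; congr 1; abel

/-- The reflection of `midSet a b` in the midpoint of `a` and `b`. -/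
def midSetReflection (a b : E) : midSet a b ≃ᵢ midSet a b where
  toFun x := ⟨a + b - x, sub_mem_midSet x.2⟩
  invFun x := ⟨a + b - x, sub_mem_midSet x.2⟩
  left_inv x := by simp
  right_inv x := by simp
  isometry_toFun := Isometry.of_dist_eq fun x y => by
    simp only [Subtype.dist_eq, dist_sub_left]

theorem dist_midSetReflection_self (a b : E) (x : midSet a b) :
    dist (midSetReflection a b x) x =
      2 * dist x ⟨midpoint ℝ a b, midpoint_mem_midSet a b⟩ := by
  rw [Subtype.dist_eq, Subtype.dist_eq, dist_eq_norm, dist_eq_norm]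
  have : ((midSetReflection a b x : E) - (x : E)) =
      (-2 : ℝ) • ((x : E) - midpoint ℝ a b) := by
    change a + b - (x : E) - x = _
    rw [midpoint_eq_smul_add, invOf_eq_inv]
    module
  rw [this, norm_smul]
  norm_num

variable {F : Type*} [NormedAddCommGroup F] [NormedSpace ℝ F]

/-- `midSet` is defined by distances alone, so `T` carries one such set onto the other. Both are
symmetric about their midpoints, and the centers must correspond. -/
theorem map_midpoint_of_midSet_subset {X : Set E} {Y : Set F} {T : E → F}
    (hTY : SurjOn T X Y) (hT : ∀ x ∈ X, ∀ y ∈ X, dist (T x) (T y) = dist x y) {a b : E}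
    (ha : a ∈ X) (hb : b ∈ X) (hX : midSet a b ⊆ X) (hY : midSet (T a) (T b) ⊆ Y) :
    T (midpoint ℝ a b) = midpoint ℝ (T a) (T b) := by
  have hab := hT a ha b hb
  have hmaps : ∀ x ∈ midSet a b, T x ∈ midSet (T a) (T b) := fun x hx =>
    ⟨by rw [hT x (hX hx) a ha, hab]; exact hx.1, by rw [hT x (hX hx) b hb, hab]; exact hx.2⟩
  let f : midSet a b → midSet (T a) (T b) := fun x => ⟨T x, hmaps x x.2⟩
  have hf : Isometry f := Isometry.of_dist_eq fun x y => hT x (hX x.2) y (hX y.2)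
  have hs : Function.Surjective f := by
    rintro ⟨y, hy⟩
    obtain ⟨x, hx, rfl⟩ := hTY (hY hy)
    exact ⟨⟨x, by rw [← hT x hx a ha, ← hab]; exact hy.1,
      by rw [← hT x hx b hb, ← hab]; exact hy.2⟩, rfl⟩
  have hC : ∀ x y : midSet a b, dist x y ≤ dist a b := fun x y =>
    (dist_triangle_right (x : E) (y : E) a).trans (by rw [x.2.1, y.2.1]; linarith)
  have := IsometryEquiv.map_center_of_reflection hC (midSetReflection a b) _
    (dist_midSetReflection_self a b) (midSetReflection (T a) (T b)) _
    (dist_midSetReflection_self (T a) (T b)) ⟨Equiv.ofBijective f ⟨hf.injective, hs⟩, hf⟩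
  exact congrArg Subtype.val this

/-- **Local Mazur–Ulam theorem**: an isometry between open sets preserves the midpoint of every
segment contained in its domain. -/
theorem map_midpoint_of_segment_subset {X : Set E} {Y : Set F} {T : E → F}
    (hXo : IsOpen X) (hYo : IsOpen Y) (hTm : MapsTo T X Y)
    (hTY : SurjOn T X Y) (hT : ∀ x ∈ X, ∀ y ∈ X, dist (T x) (T y) = dist x y) {a b : E}
    (hab : segment ℝ a b ⊆ X) :
    T (midpoint ℝ a b) = midpoint ℝ (T a) (T b) := by
  have hcont : ContinuousOn T X := by
    refine LipschitzOnWith.continuousOn (K := 1) (LipschitzOnWith.of_dist_le_mul fun x hx y hy => ?_)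
    simp [hT x hx y hy]
  have hK : IsCompact (segment ℝ a b) := by
    rw [segment_eq_image_lineMap]
    exact isCompact_Icc.image AffineMap.lineMap_continuous
  -- Compactness gives uniform room around the segment and its image, so `midSet` of two close
  -- points of the segment stays in the domain.
  obtain ⟨δ, hδ, hδX⟩ := hK.exists_thickening_subset_open hXo hab
  obtain ⟨η, hη, hηY⟩ := (hK.image_of_continuousOn (hcont.mono hab)).exists_thickening_subset_open
    hYo (image_subset_iff.2 fun x hx => hTm (hab hx))
  have key : ∀ p ∈ segment ℝ a b, ∀ q ∈ segment ℝ a b, dist p q / 2 < min δ η →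
      T (midpoint ℝ p q) = midpoint ℝ (T p) (T q) := by
    intro p hp q hq hpq
    refine map_midpoint_of_midSet_subset hTY hT (hab hp) (hab hq) (fun x hx => hδX ?_)
      (fun y hy => hηY ?_)
    · exact Metric.mem_thickening_iff.2 ⟨p, hp, by rw [hx.1]; exact hpq.trans_le (min_le_left _ _)⟩
    · refine Metric.mem_thickening_iff.2 ⟨T p, mem_image_of_mem _ hp, ?_⟩
      rw [hy.1, hT p (hab hp) q (hab hq)]
      exact hpq.trans_le (min_le_right _ _)
  obtain ⟨N, hN⟩ := exists_nat_gt (dist a b / min δ η)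
  have hmin : 0 < min δ η := lt_min hδ hη
  have hN0 : (0 : ℝ) < N := (div_nonneg dist_nonneg hmin.le).trans_lt hN
  -- An even number of pieces makes the midpoint a node, `p N`. Nodes two apart are close enough for
  -- `key`, so the second differences of `T ∘ p` vanish.
  let p : ℕ → E := fun k => AffineMap.lineMap a b ((k : ℝ) / (2 * N))
  have hp : ∀ k : ℕ, k ≤ 2 * N → p k ∈ segment ℝ a b := by
    intro k hk
    rw [segment_eq_image_lineMap]
    refine mem_image_of_mem _ ⟨by positivity, ?_⟩
    rw [div_le_one (by positivity)]
    exact_mod_cast hk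
  have hstep : ∀ k : ℕ, k + 2 ≤ 2 * N → T (p (k + 1)) = midpoint ℝ (T (p k)) (T (p (k + 2))) := by
    intro k hk
    rw [← key _ (hp k (by omega)) _ (hp _ hk)]
    · congr 1
      simp only [p, midpoint_eq_smul_add, invOf_eq_inv, AffineMap.lineMap_apply_module]
      push_cast
      match_scalars <;> field_simp <;> ring
    · rw [dist_lineMap_lineMap, Real.dist_eq]
      have : ((k : ℝ) / (2 * N) - ((k + 2 : ℕ) : ℝ) / (2 * N)) = - (1 / N) := by
        push_cast; field_simp; ring
      rw [this, abs_neg, abs_of_pos (by positivity)]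
      rw [div_lt_iff₀ hmin] at hN
      rw [one_div, inv_mul_eq_div, div_div, div_lt_iff₀ (by positivity)]
      have := mul_pos hN0 hmin
      nlinarith
  have hlin : ∀ k : ℕ, k + 1 ≤ 2 * N → T (p k) = T (p 0) + (k : ℝ) • (T (p 1) - T (p 0)) ∧
      T (p (k + 1)) = T (p 0) + ((k + 1 : ℕ) : ℝ) • (T (p 1) - T (p 0)) := by
    intro k
    induction k with
    | zero => intro _; simp
    | succ k ih =>
      intro hk
      obtain ⟨h1, h2⟩ := ih (by omega)
      refine ⟨h2, ?_⟩
      have h3 := hstep k (by omega)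
      rw [midpoint_eq_smul_add, invOf_eq_inv] at h3
      have h4 : T (p (k + 2)) = (2 : ℝ) • T (p (k + 1)) - T (p k) := by
        rw [h3]; module
      rw [show k + 1 + 1 = k + 2 from rfl, h4, h2, h1]
      push_cast
      module
  have hN1 : 1 ≤ N := by exact_mod_cast hN0
  have e0 : p 0 = a := by simp [p]
  have eN : p N = midpoint ℝ a b := by
    simp only [p, midpoint]
    congr 1
    simp
    field_simp
  have e2 : p (2 * N) = b := by
    simp only [p]
    push_cast
    rw [div_self (by positivity)]
    simp
  have hA := (hlin N (by omega)).1
  have hB := (hlin (2 * N - 1) (by omega)).2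
  rw [show 2 * N - 1 + 1 = 2 * N by omega, e2] at hB
  rw [eN] at hA
  rw [hA, ← e0, midpoint_eq_smul_add, invOf_eq_inv, e0, hB, ← e0]
  push_cast
  module

end MidSet

/-! ### Affine extension from an open cone -/

section Cone

variable {E F : Type*} [NormedAddCommGroup E] [NormedSpace ℝ E]

/-- The open convex cone spanned by the open unit ball around `e`. -/
def ballCone (e : E) : Set E := {c | ∃ r : ℝ, 0 < r ∧ ‖c - r • e‖ < r}

theorem self_mem_ballCone (e : E) : e ∈ ballCone e := ⟨1, one_pos, by simp⟩

theorem smul_mem_ballCone {e c : E} (hc : c ∈ ballCone e) {t : ℝ} (ht : 0 < t) :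
    t • c ∈ ballCone e := by
  obtain ⟨r, hr, h⟩ := hc
  refine ⟨t * r, mul_pos ht hr, ?_⟩
  rw [mul_smul, ← smul_sub, norm_smul, Real.norm_of_nonneg ht.le]
  exact mul_lt_mul_of_pos_left h ht

theorem add_mem_ballCone {e c d : E} (hc : c ∈ ballCone e) (hd : d ∈ ballCone e) :
    c + d ∈ ballCone e := by
  obtain ⟨r, hr, h⟩ := hc
  obtain ⟨s, hs, h'⟩ := hd
  refine ⟨r + s, add_pos hr hs, ?_⟩
  rw [show c + d - (r + s) • e = (c - r • e) + (d - s • e) by module]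
  exact (norm_add_le _ _).trans_lt (add_lt_add h h')

theorem add_smul_mem_ballCone {e x : E} {r : ℝ} (h : ‖x‖ < r) : x + r • e ∈ ballCone e :=
  ⟨r, (norm_nonneg x).trans_lt h, by simpa using h⟩

theorem segment_subset_ballCone {e c d : E} (hc : c ∈ ballCone e) (hd : d ∈ ballCone e) :
    segment ℝ c d ⊆ ballCone e := by
  rintro _ ⟨s, t, hs, ht, hst, rfl⟩
  rcases hs.eq_or_lt with rfl | hs
  · simpa [show t = 1 by linarith] using hd
  rcases ht.eq_or_lt with rfl | ht
  · simpa [show s = 1 by linarith] using hc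
  exact add_mem_ballCone (smul_mem_ballCone hc hs) (smul_mem_ballCone hd ht)

variable [NormedAddCommGroup F] [NormedSpace ℝ F] [CompleteSpace F]

/-- An isometry which preserves midpoints on the cone `ballCone e` is there, up to a constant,
additive. -/
theorem exists_forall_map_add_of_ballCone {e : E} {T : E → F}
    (hT : ∀ x ∈ ballCone e, ∀ y ∈ ballCone e, dist (T x) (T y) = dist x y)
    (hmid : ∀ x ∈ ballCone e, ∀ y ∈ ballCone e, T (midpoint ℝ x y) = midpoint ℝ (T x) (T y)) :
    ∃ u : F, ∀ x ∈ ballCone e, ∀ y ∈ ballCone e, T (x + y) - u = (T x - u) + (T y - u) := by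
  have hpos : ∀ n : ℕ, (0 : ℝ) < 1 / ((n : ℝ) + 1) := fun n => Nat.one_div_pos_of_nat
  have hlim : Tendsto (fun n : ℕ => 1 / ((n : ℝ) + 1)) atTop (𝓝 0) :=
    tendsto_one_div_add_atTop_nhds_zero_nat
  have hmem : ∀ c ∈ ballCone e, ∀ n : ℕ, (1 / ((n : ℝ) + 1)) • c ∈ ballCone e :=
    fun c hc n => smul_mem_ballCone hc (hpos n)
  -- The limit `u` stands in for the value of `T` at the apex `0`, which need not lie in the cone.
  have hcau : CauchySeq fun n : ℕ => T ((1 / ((n : ℝ) + 1)) • e) := by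
    have h1 : CauchySeq fun n : ℕ => (1 / ((n : ℝ) + 1)) • e := (hlim.smul_const e).cauchySeq
    rw [Metric.cauchySeq_iff] at h1 ⊢
    intro ε hε
    obtain ⟨N, hN⟩ := h1 ε hε
    refine ⟨N, fun m hm n hn => ?_⟩
    rw [hT _ (hmem e (self_mem_ballCone e) m) _ (hmem e (self_mem_ballCone e) n)]
    exact hN m hm n hn
  obtain ⟨u, hu⟩ := cauchySeq_tendsto_of_complete hcau
  have huc : ∀ c ∈ ballCone e, Tendsto (fun n : ℕ => T ((1 / ((n : ℝ) + 1)) • c)) atTop (𝓝 u) := by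
    intro c hc
    refine tendsto_of_tendsto_of_dist hu ?_
    have : ∀ n : ℕ, dist (T ((1 / ((n : ℝ) + 1)) • e)) (T ((1 / ((n : ℝ) + 1)) • c)) =
        1 / ((n : ℝ) + 1) * dist e c := fun n => by
      rw [hT _ (hmem e (self_mem_ballCone e) n) _ (hmem c hc n), dist_smul₀,
        Real.norm_of_nonneg (hpos n).le]
    simp only [this]
    simpa using hlim.mul_const (dist e c)
  have hhalf : ∀ c ∈ ballCone e, T ((1 / 2 : ℝ) • c) - u = (1 / 2 : ℝ) • (T c - u) := by
    intro c hc
    have hc2 := smul_mem_ballCone hc (show (0 : ℝ) < 1 / 2 by norm_num)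
    have h1 : Tendsto (fun n : ℕ => T (midpoint ℝ c ((1 / ((n : ℝ) + 1)) • c))) atTop
        (𝓝 (T ((1 / 2 : ℝ) • c))) := by
      rw [tendsto_iff_dist_tendsto_zero]
      have h2 : Tendsto (fun n : ℕ => dist (midpoint ℝ c ((1 / ((n : ℝ) + 1)) • c))
          ((1 / 2 : ℝ) • c)) atTop (𝓝 0) := by
        rw [← tendsto_iff_dist_tendsto_zero]
        simp only [midpoint_eq_smul_add, invOf_eq_inv]
        have := ((hlim.smul_const c).const_add c).const_smul (2⁻¹ : ℝ)
        simpa using this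
      refine h2.congr fun n => ?_
      rw [hT _ (segment_subset_ballCone hc (hmem c hc n) (midpoint_mem_segment _ _)) _ hc2]
    have h2 : Tendsto (fun n : ℕ => T (midpoint ℝ c ((1 / ((n : ℝ) + 1)) • c))) atTop
        (𝓝 ((2⁻¹ : ℝ) • (T c + u))) := by
      have : ∀ n : ℕ, T (midpoint ℝ c ((1 / ((n : ℝ) + 1)) • c)) =
          (2⁻¹ : ℝ) • (T c + T ((1 / ((n : ℝ) + 1)) • c)) := fun n => by
        rw [hmid c hc _ (hmem c hc n), midpoint_eq_smul_add, invOf_eq_inv]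
      simp only [this]
      exact ((huc c hc).const_add _).const_smul _
    rw [tendsto_nhds_unique h1 h2]
    module
  refine ⟨u, fun x hx y hy => ?_⟩
  have h := hhalf (x + y) (add_mem_ballCone hx hy)
  rw [one_div, ← invOf_eq_inv, ← midpoint_eq_smul_add, hmid x hx y hy, midpoint_eq_smul_add,
    invOf_eq_inv] at h
  have h2 : T (x + y) - u = (2 : ℝ) • ((2 : ℝ)⁻¹ • (T (x + y) - u)) := by
    rw [smul_smul]; norm_num
  rw [h2, ← h]
  module

/-- Every `x` is a difference of cone elements, `(x + r • e) - r • e` with `r > ‖x‖`, so additivity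
on the cone determines an additive isometry of the whole space; continuity makes it real linear. -/
theorem exists_linearIsometryEquiv_of_ballCone_subset {X : Set E} {Y : Set F} {T : E → F}
    (hXo : IsOpen X) (hYo : IsOpen Y) (hTm : MapsTo T X Y)
    (hTY : SurjOn T X Y) (hT : ∀ x ∈ X, ∀ y ∈ X, dist (T x) (T y) = dist x y) {e : E}
    (he : ballCone e ⊆ X) :
    ∃ (S : E ≃ₗᵢ[ℝ] F) (u : F), ∀ c ∈ ballCone e, T c = S c + u := by
  obtain ⟨u, hu⟩ := exists_forall_map_add_of_ballCone (e := e) (T := T)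
    (fun x hx y hy => hT x (he hx) y (he hy))
    (fun x hx y hy => map_midpoint_of_segment_subset hXo hYo hTm hTY hT
      ((segment_subset_ballCone hx hy).trans he))
  have hre : ∀ {r : ℝ}, 0 < r → r • e ∈ ballCone e := fun hr =>
    smul_mem_ballCone (self_mem_ballCone e) hr
  let S₀ : E → F := fun x => T (x + (‖x‖ + 1) • e) - T ((‖x‖ + 1) • e)
  have hpos : ∀ x : E, 0 < ‖x‖ + 1 := fun x => by positivity
  have hS : ∀ (x : E), ∀ c ∈ ballCone e, x + c ∈ ballCone e → S₀ x = T (x + c) - T c := by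
    intro x c hc hxc
    have hx := add_smul_mem_ballCone (e := e) (lt_add_one ‖x‖)
    have h1 := hu _ hx c hc
    have h2 := hu _ hxc _ (hre (hpos x))
    rw [show x + (‖x‖ + 1) • e + c = x + c + (‖x‖ + 1) • e by abel, h2] at h1
    simp only [S₀]
    linear_combination (norm := module) -h1
  have hSadd : ∀ x y, S₀ (x + y) = S₀ x + S₀ y := by
    intro x y
    have hx := add_smul_mem_ballCone (e := e) (lt_add_one ‖x‖)
    have hy := add_smul_mem_ballCone (e := e) (lt_add_one ‖y‖)
    have hxy := add_mem_ballCone hx hy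
    have e1 : x + (‖x‖ + 1) • e + (y + (‖y‖ + 1) • e) =
      (x + y) + ((‖x‖ + 1) • e + (‖y‖ + 1) • e) := by abel
    have h0 := add_mem_ballCone (hre (hpos x)) (hre (hpos y))
    rw [hS (x + y) _ h0 (by rwa [← e1]), ← e1]
    have h1 := hu _ hx _ hy
    have h2 := hu _ (hre (hpos x)) _ (hre (hpos y))
    simp only [S₀]
    linear_combination (norm := module) h1 - h2
  have hSnorm : ∀ x, ‖S₀ x‖ = ‖x‖ := by
    intro x
    simp only [S₀]
    rw [← dist_eq_norm, hT _ (he (add_smul_mem_ballCone (lt_add_one ‖x‖))) _ (he (hre (hpos x))),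
      dist_eq_norm, add_sub_cancel_right]
  let S₁ : E →+ F := AddMonoidHom.mk' S₀ hSadd
  have hcont : Continuous S₁ := (AddMonoidHomClass.isometry_of_norm S₁ hSnorm).continuous
  let S₂ : E →ₗᵢ[ℝ] F := ⟨(S₁.toRealLinearMap hcont : E →ₗ[ℝ] F), hSnorm⟩
  have hS₂ : ∀ x, S₂ x = S₀ x := fun _ => rfl
  have hTS : ∀ c ∈ ballCone e, T c = S₂ c + u := by
    intro c hc
    have h := hu c hc e (self_mem_ballCone e)
    rw [hS₂, hS c e (self_mem_ballCone e) (add_mem_ballCone hc (self_mem_ballCone e))]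
    linear_combination (norm := module) -h
  -- A point of `Y` near `T e` has a preimage within `1` of `e`, hence in the cone where `T` is
  -- affine. So the range of `S₂` contains a ball about `0`.
  have hsurj : Function.Surjective S₂ := by
    obtain ⟨ε, hε, hball⟩ := Metric.isOpen_iff.1 hYo _ (hTm (he (self_mem_ballCone e)))
    have hsmall : ∀ w : F, ‖w‖ < min ε 1 → ∃ x, S₂ x = w := by
      intro w hw
      obtain ⟨f, hf, hfw⟩ := hTY (hball (show T e + w ∈ Metric.ball (T e) ε by
        simpa using hw.trans_le (min_le_left _ _)))
      have hfe : ‖f - e‖ < 1 := by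
        rw [← dist_eq_norm, ← hT f hf e (he (self_mem_ballCone e)), hfw, dist_eq_norm,
          add_sub_cancel_left]
        exact hw.trans_le (min_le_right _ _)
      have hfU : f ∈ ballCone e := ⟨1, one_pos, by simpa using hfe⟩
      refine ⟨f - e, ?_⟩
      have h1 := hTS f hfU
      have h2 := hTS e (self_mem_ballCone e)
      rw [map_sub]
      rw [hfw] at h1
      linear_combination (norm := module) h2 - h1
    intro w
    have hm : 0 < min ε 1 := lt_min hε one_pos
    set t : ℝ := min ε 1 / (‖w‖ + 1) with ht
    have ht0 : 0 < t := div_pos hm (by positivity)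
    obtain ⟨x, hx⟩ := hsmall (t • w) (by
      rw [norm_smul, Real.norm_of_nonneg ht0.le, ht, div_mul_eq_mul_div, div_lt_iff₀ (by positivity)]
      exact mul_lt_mul_of_pos_left (lt_add_one _) hm)
    refine ⟨t⁻¹ • x, ?_⟩
    rw [map_smul, hx, smul_smul, inv_mul_cancel₀ ht0.ne', one_smul]
  exact ⟨LinearIsometryEquiv.ofSurjective S₂ hsurj, u, hTS⟩

end Cone

/-! ### Zero-free entire functions of exponential type -/

section EntireFunctions

/-- A zero-free entire function of exponential type has constant logarithmic derivative; here the
derivative of the latter is computed at `0`. -/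
theorem deriv_logDeriv_eq_zero_of_norm_le_exp {f f' : ℂ → ℂ}
    (hf : ∀ z, HasDerivAt f (f' z) z) (hne : ∀ z, f z ≠ 0) (h0 : f 0 = 1) {K C : ℝ}
    (hC : 0 ≤ C) (hK : ∀ z, ‖f z‖ ≤ K * Real.exp (C * ‖z‖)) :
    deriv (fun z => f' z / f z) 0 = 0 := by
  have hfd : Differentiable ℂ f := fun z => (hf z).differentiableAt
  have hf'd : Differentiable ℂ f' := by
    have : f' = deriv f := funext fun z => (hf z).deriv.symm
    rw [this]
    exact hfd.deriv
  obtain ⟨h, hh0, hh⟩ := (hf'd.div hfd hne).isExactOn_univ.with_val_at 0 0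
  replace hh : ∀ z, HasDerivAt h (f' z / f z) z := fun z => hh z (mem_univ z)
  have hhd : Differentiable ℂ h := fun z => (hh z).differentiableAt
  have hexp : ∀ z, f z * Complex.exp (-h z) = 1 := by
    intro z
    have hd : ∀ z, HasDerivAt (fun z => f z * Complex.exp (-h z)) 0 z := by
      intro z
      convert! (hf z).mul ((hh z).neg.cexp) using 1
      have := hne z
      field_simp
      ring
    have := is_const_of_deriv_eq_zero (fun z => (hd z).differentiableAt) (fun z => (hd z).deriv) z 0
    simpa [h0, hh0] using this
  have hK1 : 1 ≤ K := by simpa [h0] using hK 0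
  have hre : ∀ z, (h z).re ≤ Real.log K + C * ‖z‖ := by
    intro z
    have h1 : f z = Complex.exp (h z) := by
      have := hexp z
      rwa [Complex.exp_neg, mul_inv_eq_one₀ (Complex.exp_ne_zero _)] at this
    have h2 := hK z
    rw [h1, Complex.norm_exp] at h2
    rw [← Real.log_exp (h z).re, ← Real.log_exp (C * ‖z‖),
      ← Real.log_mul (by positivity) (Real.exp_pos _).ne']
    exact Real.log_le_log (Real.exp_pos _) h2
  have hlog : 0 ≤ Real.log K := Real.log_nonneg hK1
  -- Borel–Carathéodory on radius `R` bounds the logarithm `h` on radius `R / 2`; Cauchy's estimate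
  -- then makes its second derivative `O(1 / R)`. The `+ 1` keeps the bound on the real part
  -- positive.
  have hbound : ∀ R : ℝ, 0 < R →
      ‖iteratedDeriv 2 h 0‖ ≤ 16 * (Real.log K + C * R + 1) / R ^ 2 := by
    intro R hR
    have hM : 0 < Real.log K + C * R + 1 := by positivity
    have := Complex.norm_iteratedDeriv_le_of_forall_mem_sphere_norm_le (c := 0) (R := R / 2)
      (C := 2 * (Real.log K + C * R + 1)) 2 (half_pos hR) hhd.diffContOnCl (f := h) ?_
    · refine this.trans (le_of_eq ?_)
      simp [Nat.factorial]
      field_simp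
      ring
    · intro z hz
      have hz' : ‖z‖ = R / 2 := by simpa using hz
      have := Complex.borelCaratheodory_zero hM (R := R) (hhd.differentiableOn) ?_ hR
        (z := z) (by simp [hz']; linarith) hh0
      · refine this.trans (le_of_eq ?_)
        rw [hz']
        field_simp
        ring
      · intro w hw
        have hw' : ‖w‖ < R := by simpa using hw
        have := mul_le_mul_of_nonneg_left hw'.le hC
        have := hre w
        simp only [mem_ofPred_eq]
        linarith
  have hlim : Tendsto (fun R : ℝ => 16 * (Real.log K + C * R + 1) / R ^ 2) atTop (𝓝 0) := by
    have h1 : Tendsto (fun R : ℝ => R⁻¹) atTop (𝓝 0) := tendsto_inv_atTop_zero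
    have h2 : Tendsto (fun R : ℝ => 16 * (Real.log K * (R⁻¹ * R⁻¹) + C * R⁻¹ + R⁻¹ * R⁻¹)) atTop
        (𝓝 (16 * (Real.log K * (0 * 0) + C * 0 + 0 * 0))) :=
      ((((h1.mul h1).const_mul _).add (h1.const_mul _)).add (h1.mul h1)).const_mul _
    simp only [mul_zero, add_zero] at h2
    refine h2.congr' ?_
    filter_upwards [eventually_gt_atTop 0] with R hR
    field_simp
  have hz : ‖iteratedDeriv 2 h 0‖ ≤ 0 :=
    ge_of_tendsto hlim ((eventually_gt_atTop 0).mono hbound)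
  have hd : deriv h = fun z => f' z / f z := funext fun z => (hh z).deriv
  rw [← hd, ← norm_le_zero_iff]
  simpa [iteratedDeriv_succ] using hz

end EntireFunctions

/-! ### Gleason–Kahane–Żelazko, complex and real linear -/

section GleasonKahaneZelazko

variable {B : Type*} [NormedRing B] [NormedAlgebra ℂ B] [CompleteSpace B]

theorem norm_exp_le_norm_one_mul (x : B) : ‖exp x‖ ≤ (‖(1 : B)‖ + 1) * Real.exp ‖x‖ := by
  have h := NormedSpace.exp_series_hasSum_exp' (𝕂 := ℂ) x
  have h2 := (NormedSpace.exp_series_hasSum_exp' (𝕂 := ℝ) ‖x‖).mul_left (‖(1 : B)‖ + 1)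
  rw [← Real.exp_eq_exp_ℝ] at h2
  refine h.norm_le_of_bounded h2 fun n => ?_
  have e : ‖((n.factorial : ℂ)⁻¹)‖ = (n.factorial : ℝ)⁻¹ := by simp
  rw [norm_smul, e, smul_eq_mul, mul_left_comm]
  refine mul_le_mul_of_nonneg_left ?_ (by positivity)
  rcases n.eq_zero_or_pos with rfl | hn
  · simp
  · exact (norm_pow_le' x hn).trans (le_mul_of_one_le_left (by positivity) (by simp))

/-- The logarithmic derivative of `z ↦ α (exp (z • b))` has derivative `α (b * b) - α b * α b` at
`0`. -/
theorem map_sq_of_forall_map_exp_ne_zero (α : B →L[ℂ] ℂ) (h1 : α 1 = 1)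
    (hne : ∀ b, α (exp b) ≠ 0) (b : B) : α (b * b) = α b * α b := by
  have hd : ∀ z : ℂ, HasDerivAt (fun z : ℂ => α (exp (z • b))) (α (exp (z • b) * b)) z :=
    fun z => α.hasFDerivAt.comp_hasDerivAt z (hasDerivAt_exp_smul_const b z)
  have h := deriv_logDeriv_eq_zero_of_norm_le_exp hd (fun z => hne _) (by simp [h1])
    (K := ‖α‖ * (‖(1 : B)‖ + 1)) (C := ‖b‖) (norm_nonneg b) (fun z => by
      refine (α.le_opNorm _).trans ?_
      rw [mul_assoc]
      refine mul_le_mul_of_nonneg_left ?_ (norm_nonneg _)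
      rw [mul_comm ‖b‖, ← norm_smul]
      exact norm_exp_le_norm_one_mul _)
  have hd2 : HasDerivAt (fun z : ℂ => α (exp (z • b) * b)) (α (exp ((0 : ℂ) • b) * b * b)) 0 :=
    α.hasFDerivAt.comp_hasDerivAt 0 ((hasDerivAt_exp_smul_const b (0 : ℂ)).mul_const b)
  have h3 := (hd2.fun_div (hd 0) (hne _)).deriv
  rw [h] at h3
  simp [h1] at h3
  exact (sub_eq_zero.1 h3.symm)

/-- **Gleason–Kahane–Żelazko theorem**. -/
theorem exists_algHom_of_forall_map_exp_ne_zero (α : B →L[ℂ] ℂ) (h1 : α 1 = 1)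
    (hne : ∀ b, α (exp b) ≠ 0) : ∃ χ : B →ₐ[ℂ] ℂ, ∀ b, χ b = α b := by
  have hsq := map_sq_of_forall_map_exp_ne_zero α h1 hne
  have hj : ∀ a b, α (a * b) + α (b * a) = 2 * (α a * α b) := by
    intro a b
    have h := hsq (a + b)
    simp only [add_mul, mul_add, map_add, hsq] at h
    linear_combination h
  have hker : ∀ a b, α a = 0 → α (a * b) = 0 := by
    intro a b ha
    have h2 := hj a b
    rw [ha, zero_mul, mul_zero] at h2
    have h3 := hsq (a * b - b * a)
    have h4 := hsq (a * b + b * a)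
    have h5 := hj a (b * a * b)
    rw [ha, zero_mul, mul_zero] at h5
    -- Both `α (a * b + b * a)` and the right-hand side vanish when `α a = 0`, so `α` kills the
    -- commutator too.
    have h6 : α ((a * b - b * a) * (a * b - b * a)) + α ((a * b + b * a) * (a * b + b * a)) =
        2 * (α (a * (b * a * b)) + α (b * a * b * a)) := by
      simp only [← map_add]
      rw [two_mul (α _), ← map_add]
      congr 1
      noncomm_ring
    rw [h3, h4, h5, map_add, map_sub, h2] at h6
    have h7 : (α (a * b) - α (b * a)) * (α (a * b) - α (b * a)) = 0 := by
      linear_combination h6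
    have h8 := mul_self_eq_zero.1 h7
    linear_combination (h2 + h8) / 2
  refine ⟨AlgHom.ofLinearMap α.toLinearMap h1 fun a b => ?_, fun b => rfl⟩
  have h := hker (a - algebraMap ℂ B (α a)) b (by
    rw [map_sub, Algebra.algebraMap_eq_smul_one, map_smul, h1]; simp)
  rw [sub_mul, map_sub, ← Algebra.smul_def, map_smul, sub_eq_zero] at h
  exact h

theorem smul_exp_mem_range_exp (b : B) {c : ℂ} (hc : c ≠ 0) : c • exp b ∈ range (exp : B → B) := by
  let _ : NormedAlgebra ℚ B := .restrictScalars ℚ ℂ B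
  refine ⟨b + algebraMap ℂ B (Complex.log c), ?_⟩
  rw [exp_add_of_commute (Algebra.commutes _ _).symm, ← algebraMap_exp_comm,
    ← Complex.exp_eq_exp_ℂ, Complex.exp_log hc, ← Algebra.commutes, ← Algebra.smul_def]

omit [CompleteSpace B] in
/-- The complex linear part of a real linear functional. -/
theorem exists_complexLinear_part (ψ : B →L[ℝ] ℂ) :
    ∃ α : B →L[ℂ] ℂ, ∀ b, α b = (ψ b - Complex.I * ψ (Complex.I • b)) / 2 := by
  refine ⟨⟨⟨⟨fun b => (ψ b - Complex.I * ψ (Complex.I • b)) / 2, fun x y => ?_⟩, fun c x => ?_⟩,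
    by fun_prop⟩, fun b => rfl⟩
  · simp only [smul_add, map_add]; ring
  · have hr : ∀ (r : ℝ) (y : B), ψ ((r : ℂ) • y) = r * ψ y := fun r y => by
      rw [Complex.coe_smul, map_smul, Complex.real_smul]
    have h1 : ψ (c • x) = c.re * ψ x + c.im * ψ (Complex.I • x) := by
      conv_lhs => rw [← Complex.re_add_im c, add_smul, mul_smul]
      rw [map_add, hr, hr]
    have h2 : ψ (Complex.I • c • x) = c.re * ψ (Complex.I • x) - c.im * ψ x := by
      have : Complex.I • c • x = (c.re : ℂ) • (Complex.I • x) - (c.im : ℂ) • x := by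
        conv_lhs => rw [← Complex.re_add_im c]
        simp only [smul_smul, ← sub_smul]
        congr 1
        linear_combination (c.im : ℂ) * Complex.I_mul_I
      rw [this, map_sub, hr, hr]
    simp only [RingHom.id_apply, smul_eq_mul]
    rw [h1, h2]
    conv_rhs => rw [← Complex.re_add_im c]
    linear_combination ((c.im : ℂ) * ψ (Complex.I • x) / 2) * Complex.I_mul_I

/-- Gleason–Kahane–Żelazko applies to `α / α 1`. The quotient of `β` by `α` along `z ↦ exp (z • b)`
is entire and bounded, so Liouville makes `β` proportional to `α`. -/
theorem exists_algHom_of_norm_map_exp_lt (α β : B →L[ℂ] ℂ)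
    (hlt : ∀ b, ‖β (exp b)‖ < ‖α (exp b)‖) :
    ∃ χ : B →ₐ[ℂ] ℂ, (∀ b, α b = α 1 * χ b) ∧ ∀ b, β b = β 1 * χ b := by
  have hne : ∀ b, α (exp b) ≠ 0 := fun b => norm_pos_iff.1 ((norm_nonneg _).trans_lt (hlt b))
  have hα1 : α 1 ≠ 0 := by simpa using hne 0
  obtain ⟨χ, hχ⟩ := exists_algHom_of_forall_map_exp_ne_zero ((α 1)⁻¹ • α)
    (by simp [hα1]) (fun b => by simp [hα1, hne])
  have hα : ∀ b, α b = α 1 * χ b := fun b => by simp [hχ, hα1]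
  refine ⟨χ, hα, fun b => ?_⟩
  have hd : ∀ (γ : B →L[ℂ] ℂ) (z : ℂ),
      HasDerivAt (fun z : ℂ => γ (exp (z • b))) (γ (exp (z • b) * b)) z :=
    fun γ z => γ.hasFDerivAt.comp_hasDerivAt z (hasDerivAt_exp_smul_const b z)
  have hq : Differentiable ℂ fun z : ℂ => β (exp (z • b)) / α (exp (z • b)) := fun z =>
    ((hd β z).div (hd α z) (hne _)).differentiableAt
  have hconst : ∀ z : ℂ, β (exp (z • b)) = β 1 / α 1 * α (exp (z • b)) := by
    intro z
    have := hq.apply_eq_apply_of_bounded (isBounded_iff_forall_norm_le.2 ⟨1, ?_⟩) z 0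
    · rw [div_eq_iff (hne _)] at this
      simpa using this
    · rintro _ ⟨w, rfl⟩
      simp only [norm_div]
      exact div_le_one_of_le₀ (hlt _).le (norm_nonneg _)
  have h1 := (hd β 0).unique (((hd α 0).const_mul (β 1 / α 1)).congr_of_eventuallyEq
    (Eventually.of_forall hconst))
  simp only [zero_smul, exp_zero, one_mul] at h1
  rw [h1, hα b]
  field_simp

/-- A real linear version of the Gleason–Kahane–Żelazko theorem. -/
theorem exists_algHom_comp_of_forall_map_exp_ne_zero (ψ : B →L[ℝ] ℂ)
    (hne : ∀ b, ψ (exp b) ≠ 0) :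
    ∃ (χ : B →ₐ[ℂ] ℂ) (l : ℂ →ₗ[ℝ] ℂ), ∀ b, ψ b = l (χ b) := by
  obtain ⟨α, hα⟩ := exists_complexLinear_part ψ
  obtain ⟨β, hβ⟩ := exists_complexLinear_part (Complex.conjCLE.toContinuousLinearMap.comp ψ)
  have hψ : ∀ b, ψ b = α b + (starRingEnd ℂ) (β b) := by
    intro b
    rw [hα, hβ]
    simp [map_ofNat]
    ring
  have hab : ∀ b, ‖α (exp b)‖ ≠ ‖β (exp b)‖ := by
    intro b hb
    -- When the norms agree, `ψ` vanishes at `c • exp b` for this scalar `c`, whatever `w` is. A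
    -- nonzero `c` would make that an exponential; `w = 1` and `w = I` then give `α (exp b) = β (exp
    -- b) = 0`.
    have key : ∀ w : ℂ, w * (starRingEnd ℂ) (β (exp b)) -
        (starRingEnd ℂ) w * (starRingEnd ℂ) (α (exp b)) = 0 := by
      intro w
      by_contra h
      obtain ⟨b', hb'⟩ := smul_exp_mem_range_exp b h
      refine hne b' ?_
      rw [hb', hψ, map_smul, map_smul]
      simp only [smul_eq_mul, map_mul, map_sub, Complex.conj_conj]
      have h1 := Complex.mul_conj' (α (exp b))
      have h2 := Complex.mul_conj' (β (exp b))
      rw [hb] at h1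
      linear_combination (starRingEnd ℂ) w * (h2 - h1)
    have h1 := key 1
    have h2 := key Complex.I
    simp only [map_one, one_mul, Complex.conj_I] at h1 h2
    have h3 : Complex.I * (2 * (starRingEnd ℂ) (β (exp b))) = 0 := by
      linear_combination h2 + Complex.I * h1
    have h4 : β (exp b) = 0 := by simpa using h3
    have h5 : α (exp b) = 0 := by simpa [h4] using hb
    exact hne b (by simp [hψ, h4, h5])
  -- The norms never agree along the path `t ↦ exp (t • b)`, so the inequality at `1` persists.
  have hlt : ∀ {γ δ : B →L[ℂ] ℂ}, (∀ b, ‖γ (exp b)‖ ≠ ‖δ (exp b)‖) → ‖δ 1‖ < ‖γ 1‖ →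
      ∀ b, ‖δ (exp b)‖ < ‖γ (exp b)‖ := by
    intro γ δ hne h1 b
    by_contra! h
    have hc : Continuous fun t : ℝ => ‖γ (exp (t • b))‖ - ‖δ (exp (t • b))‖ := by
      let _ : NormedAlgebra ℚ B := .restrictScalars ℚ ℂ B
      have : Continuous fun t : ℝ => exp (t • b) :=
        (NormedSpace.exp_continuous).comp (by fun_prop)
      fun_prop
    obtain ⟨t, -, ht⟩ := intermediate_value_Icc' zero_le_one hc.continuousOn
      (show (0 : ℝ) ∈ _ from ⟨by simpa using h, by simpa using h1.le⟩)
    exact hne (t • b) (sub_eq_zero.1 ht)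
  have hfin : (∃ χ : B →ₐ[ℂ] ℂ, (∀ b, α b = α 1 * χ b) ∧ ∀ b, β b = β 1 * χ b) := by
    rcases lt_or_gt_of_ne (show ‖α 1‖ ≠ ‖β 1‖ by simpa using hab 0) with h | h
    · obtain ⟨χ, h1, h2⟩ := exists_algHom_of_norm_map_exp_lt β α (hlt (fun b => (hab b).symm) h)
      exact ⟨χ, h2, h1⟩
    · exact exists_algHom_of_norm_map_exp_lt α β (hlt hab h)
  obtain ⟨χ, h1, h2⟩ := hfin
  refine ⟨χ, LinearMap.mulLeft ℝ (α 1) +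
    Complex.conjCLE.toLinearMap ∘ₗ LinearMap.mulLeft ℝ (β 1), fun b => ?_⟩
  rw [hψ, h1 b, h2 b]
  simp

end GleasonKahaneZelazko

/-! ### Open subgroups of the unit group -/

section OpenSubgroup

variable {B : Type*} [NormedRing B] [NormedAlgebra ℂ B] [CompleteSpace B]
  {G : Subgroup Bˣ}

/-- The set of elements of the ring which lie in a given group of units. -/
def unitsCarrier {M : Type*} [Monoid M] (G : Subgroup Mˣ) : Set M := Units.val '' (G : Set Mˣ)

theorem mul_mem_unitsCarrier {M : Type*} [Monoid M] {G : Subgroup Mˣ} {x y : M}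
    (hx : x ∈ unitsCarrier G) (hy : y ∈ unitsCarrier G) : x * y ∈ unitsCarrier G := by
  obtain ⟨f, hf, rfl⟩ := hx
  obtain ⟨g, hg, rfl⟩ := hy
  exact ⟨f * g, mul_mem hf hg, rfl⟩

omit [NormedAlgebra ℂ B] in
theorem isOpen_unitsCarrier (hG : IsOpen (G : Set Bˣ)) : IsOpen (unitsCarrier G) :=
  Units.isOpenEmbedding_val.isOpenMap _ hG

-- The ball consists of units and is connected, while an open subgroup is clopen.
omit [CompleteSpace B] [NormedAlgebra ℂ B] in
theorem ball_one_subset_unitsCarrier [NormedAlgebra ℝ B] [CompleteSpace B]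
    (hG : IsOpen (G : Set Bˣ)) : Metric.ball (1 : B) 1 ⊆ unitsCarrier G := by
  have hsub : Metric.ball (1 : B) 1 ⊆ range (Units.val : Bˣ → B) := by
    intro x hx
    have hx' : ‖1 - x‖ < 1 := by rwa [Metric.mem_ball, dist_comm, dist_eq_norm] at hx
    exact ⟨Units.oneSub (1 - x) hx', by simp⟩
  have hconn : IsPreconnected (Units.val ⁻¹' Metric.ball (1 : B) 1) :=
    (convex_ball (1 : B) 1).isPreconnected.preimage_of_isOpenMap Units.val_injective
      Units.isOpenEmbedding_val.isOpenMap hsub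
  have hclopen : IsClopen (G : Set Bˣ) := OpenSubgroup.isClopen ⟨G, hG⟩
  have h := hconn.subset_isClopen hclopen ⟨1, by simp, one_mem G⟩
  intro x hx
  obtain ⟨v, rfl⟩ := hsub hx
  exact ⟨v, h hx, rfl⟩

/-- `exp b` is the `(n + 1)`-st power of `exp (b / (n + 1))`, which tends to `1`. -/
theorem exp_mem_unitsCarrier (hG : IsOpen (G : Set Bˣ)) (b : B) : exp b ∈ unitsCarrier G := by
  let _ : NormedAlgebra ℚ B := .restrictScalars ℚ ℂ B
  have hpow : ∀ x ∈ unitsCarrier G, ∀ n : ℕ, x ^ n ∈ unitsCarrier G := by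
    rintro _ ⟨f, hf, rfl⟩ n
    exact ⟨f ^ n, pow_mem hf n, by simp⟩
  have hlim : Tendsto (fun n : ℕ => exp ((1 / ((n : ℝ) + 1)) • b)) atTop (𝓝 1) := by
    have h1 : Tendsto (fun n : ℕ => (1 / ((n : ℝ) + 1)) • b) atTop (𝓝 ((0 : ℝ) • b)) :=
      tendsto_one_div_add_atTop_nhds_zero_nat.smul_const b
    have h2 := (NormedSpace.exp_continuous.tendsto ((0 : ℝ) • b)).comp h1
    simpa [Function.comp_def] using h2
  obtain ⟨n, hn⟩ := (hlim.eventually ((isOpen_unitsCarrier hG).mem_nhds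
    ⟨1, one_mem G, rfl⟩)).exists
  have h := hpow _ hn (n + 1)
  rw [← NormedSpace.exp_nsmul] at h
  convert h using 2
  rw [← Nat.cast_smul_eq_nsmul ℝ, smul_smul]
  have : (n : ℝ) + 1 ≠ 0 := by positivity
  push_cast
  rw [mul_one_div_cancel this, one_smul]

theorem smul_mem_unitsCarrier (hG : IsOpen (G : Set Bˣ)) {c : ℂ} (hc : c ≠ 0) {x : B}
    (hx : x ∈ unitsCarrier G) : c • x ∈ unitsCarrier G := by
  obtain ⟨b, hb⟩ := smul_exp_mem_range_exp (0 : B) hc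
  rw [exp_zero] at hb
  have h := mul_mem_unitsCarrier (exp_mem_unitsCarrier hG b) hx
  rwa [hb, smul_one_mul] at h

theorem ballCone_smul_one_subset_unitsCarrier (hG : IsOpen (G : Set Bˣ)) {c : ℂ} (hc : ‖c‖ = 1) :
    ballCone (c • (1 : B)) ⊆ unitsCarrier G := by
  rintro x ⟨r, hr, h⟩
  have hc0 : c ≠ 0 := norm_pos_iff.1 (by rw [hc]; exact one_pos)
  have hd : (r : ℂ) * c ≠ 0 := mul_ne_zero (by exact_mod_cast hr.ne') hc0
  have h1 : ((r : ℂ) * c)⁻¹ • x ∈ Metric.ball (1 : B) 1 := by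
    rw [Metric.mem_ball, dist_eq_norm]
    have e : ((r : ℂ) * c)⁻¹ • x - 1 = ((r : ℂ) * c)⁻¹ • (x - r • c • (1 : B)) := by
      rw [smul_sub, ← Complex.coe_smul r, smul_smul (r : ℂ), smul_smul, inv_mul_cancel₀ hd,
        one_smul]
    rw [e, norm_smul, norm_inv, norm_mul, hc, mul_one, Complex.norm_real,
      Real.norm_of_nonneg hr.le, inv_mul_lt_iff₀ hr, mul_one]
    exact h
  have h2 := smul_mem_unitsCarrier hG hd (ball_one_subset_unitsCarrier hG h1)
  rwa [smul_smul, mul_inv_cancel₀ hd, one_smul] at h2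

end OpenSubgroup

/-! ### One affine map on the whole group -/

section Rigidity

theorem isOpen_ballCone {E : Type*} [NormedAddCommGroup E] [NormedSpace ℝ E] (e : E) :
    IsOpen (ballCone e) := by
  have : ballCone e = ⋃ r : ℝ, ⋃ _ : 0 < r, Metric.ball (r • e) r := by
    ext c
    simp [ballCone, dist_eq_norm]
  rw [this]
  exact isOpen_iUnion fun r => isOpen_iUnion fun _ => Metric.isOpen_ball

theorem eq_of_eqOn_open_inter {E F : Type*} [NormedAddCommGroup E] [NormedSpace ℝ E]
    [NormedAddCommGroup F] [NormedSpace ℝ F] {S S' : E ≃ₗᵢ[ℝ] F} {u u' : F} {T : E → F}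
    {V V' : Set E} (hV : IsOpen V) (hV' : IsOpen V')
    (hS : ∀ x ∈ V, T x = S x + u) (hS' : ∀ x ∈ V', T x = S' x + u') {p : E}
    (hp : p ∈ V) (hp' : p ∈ V') : S = S' ∧ u = u' := by
  have hp0 : S p + u = S' p + u' := (hS p hp).symm.trans (hS' p hp')
  have h : S = S' := by
    ext x
    have hc : ContinuousAt (fun t : ℝ => p + t • x) 0 := by fun_prop
    have hev := hc.eventually (((hV.inter hV').mem_nhds (by simpa using ⟨hp, hp'⟩)))
    obtain ⟨t, ht, ht0⟩ := ((hev.filter_mono nhdsWithin_le_nhds).and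
      (self_mem_nhdsWithin (s := {(0 : ℝ)}ᶜ))).exists
    have h1 := (hS _ ht.1).symm.trans (hS' _ ht.2)
    simp only [map_add, map_smul] at h1
    have h2 : t • S x = t • S' x := by
      linear_combination (norm := module) h1 - hp0
    exact smul_right_injective F ht0 h2
  subst h
  exact ⟨rfl, add_left_cancel hp0⟩

/-- An element of a commutative Banach algebra which is dominated by all large scalars in the
sense of `‖c - a‖ ≤ |c|` vanishes. -/
theorem eq_zero_of_norm_sub_le {A : Type*} [NormedCommRing A] [NormedAlgebra ℂ A]
    [NormOneClass A] {a : A} {R : ℝ} (hR : 0 < R)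
    (h : ∀ c : ℂ, R ≤ ‖c‖ → ‖c • (1 : A) - a‖ ≤ ‖c‖) : a = 0 := by
  have h1 : ∀ z : ℂ, ‖z‖ = R⁻¹ → ‖1 - z • a‖ ≤ 1 := by
    intro z hz
    have hz0 : z ≠ 0 := norm_pos_iff.1 (by rw [hz]; positivity)
    have e : 1 - z • a = z • (z⁻¹ • (1 : A) - a) := by
      rw [smul_sub, smul_smul, mul_inv_cancel₀ hz0, one_smul]
    have h2 := h z⁻¹ (by rw [norm_inv, hz, inv_inv])
    rw [e, norm_smul]
    calc ‖z‖ * ‖z⁻¹ • (1 : A) - a‖ ≤ ‖z‖ * ‖z⁻¹‖ := by gcongr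
      _ = 1 := by rw [norm_inv, mul_inv_cancel₀ (norm_ne_zero_iff.2 hz0)]
  -- Cauchy's estimate for `(1 - z • a) ^ n` on `|z| = R⁻¹`, whose derivative at `0` is `-n • a`.
  have hbound : ∀ n : ℕ, (n : ℝ) * ‖a‖ ≤ R := by
    intro n
    have hd : ∀ z : ℂ, HasDerivAt (fun z : ℂ => (1 - z • a) ^ n)
        ((n : A) * (1 - z • a) ^ (n - 1) * (-a)) z := by
      intro z
      have := (((hasDerivAt_id z).smul_const a).const_sub 1).fun_pow n
      simpa using this
    have h2 := Complex.norm_deriv_le_of_forall_mem_sphere_norm_le (c := 0) (R := R⁻¹) (C := 1)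
      (f := fun z : ℂ => (1 - z • a) ^ n) (inv_pos.2 hR)
      (Differentiable.diffContOnCl fun z => (hd z).differentiableAt) (fun z hz => by
        refine (norm_pow_le _ n).trans (pow_le_one₀ (norm_nonneg _) (h1 z (by simpa using hz))))
    rw [(hd 0).deriv] at h2
    have e : (n : A) * (1 - (0 : ℂ) • a) ^ (n - 1) * (-a) = -((n : ℂ) • a) := by
      simp [Nat.cast_smul_eq_nsmul]
    rw [e, norm_neg, norm_smul] at h2
    simpa using h2
  by_contra ha
  obtain ⟨n, hn⟩ := exists_nat_gt (R / ‖a‖)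
  rw [div_lt_iff₀ (norm_pos_iff.2 ha)] at hn
  exact absurd (hbound n) (not_le.2 hn)

theorem smul_one_add_smul_one_mem_ballCone {A : Type*} [NormedRing A] [NormedAlgebra ℂ A]
    [NormOneClass A] {c d : ℂ} (hcd : ‖d - c‖ < 2) :
    c • (1 : A) + d • (1 : A) ∈ ballCone (c • (1 : A)) := by
  refine ⟨2, two_pos, ?_⟩
  rw [show c • (1 : A) + d • (1 : A) - (2 : ℝ) • c • (1 : A) = (d - c) • (1 : A) by module,
    norm_smul, norm_one, mul_one]
  exact hcd

/-- Radius `2 * z.re` is chosen because `z - 2 * z.re` is minus the conjugate of `z`. In this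
quarter plane `‖z‖ ≤ √2 * z.re`, so `‖z‖ + ‖f‖ < (5 / 4) * ‖z‖ < 2 * z.re`. -/
theorem smul_one_add_mem_ballCone {A : Type*} [NormedRing A] [NormedAlgebra ℂ A]
    [NormOneClass A] {e z : ℂ} (he : ‖e‖ = 1) (hz : |z.im| ≤ z.re) {f : A}
    (hf : 4 * ‖f‖ < ‖z‖) : (e * z) • (1 : A) + f ∈ ballCone (e • (1 : A)) := by
  have hre : 0 ≤ z.re := (abs_nonneg _).trans hz
  have hn : ‖z‖ ^ 2 ≤ 2 * z.re ^ 2 := by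
    rw [← Complex.normSq_eq_norm_sq, Complex.normSq_apply]
    nlinarith [abs_le.1 hz]
  have hzpos : 0 < ‖z‖ := by linarith [norm_nonneg f]
  have hlt : 5 * ‖z‖ < 8 * z.re := by nlinarith
  have hre0 : 0 < z.re := by linarith
  refine ⟨2 * z.re, by linarith, ?_⟩
  have e1 : (e * z) • (1 : A) + f - (2 * z.re) • e • (1 : A) =
      (e * (z - 2 * (z.re : ℂ))) • (1 : A) + f := by
    rw [← Complex.coe_smul]
    push_cast
    module
  have e2 : ‖z - 2 * (z.re : ℂ)‖ = ‖z‖ := by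
    rw [← Complex.norm_conj z, ← norm_neg]
    congr 1
    apply Complex.ext <;> simp
    ring
  rw [e1]
  refine (norm_add_le _ _).trans_lt ?_
  rw [norm_smul, norm_mul, he, e2, norm_one]
  linarith

variable {A B : Type*}
    [NormedCommRing A] [NormedAlgebra ℂ A] [NormOneClass A] [CompleteSpace A]
    [NormedRing B] [NormedAlgebra ℂ B] [CompleteSpace B]

/-- An isometry from an open group of units onto an open set extends to a real affine isometry. -/
theorem exists_linearIsometryEquiv_of_unitsCarrier {G : Subgroup Aˣ} (hG : IsOpen (G : Set Aˣ))
    {Y : Set B} {T : A → B} (hY : IsOpen Y) (hTm : MapsTo T (unitsCarrier G) Y)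
    (hTY : SurjOn T (unitsCarrier G) Y)
    (hT : ∀ x ∈ unitsCarrier G, ∀ y ∈ unitsCarrier G, dist (T x) (T y) = dist x y) :
    ∃ (S : A ≃ₗᵢ[ℝ] B) (u : B), ∀ f ∈ unitsCarrier G, T f = S f + u := by
  have hcone : ∀ e : ℂ, ‖e‖ = 1 → ∃ (S : A ≃ₗᵢ[ℝ] B) (u : B),
      ∀ c ∈ ballCone (e • (1 : A)), T c = S c + u := fun e he =>
    exists_linearIsometryEquiv_of_ballCone_subset (isOpen_unitsCarrier hG) hY hTm hTY hT
      (ballCone_smul_one_subset_unitsCarrier hG he)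
  obtain ⟨S, u, hS⟩ := hcone 1 (by simp)
  -- Since `|I - 1| < 2`, the cones at `e` and `I * e` share an open set, which determines the
  -- affine map.
  have hrot : ∀ e : ℂ, ‖e‖ = 1 → (∀ c ∈ ballCone (e • (1 : A)), T c = S c + u) →
      ∀ c ∈ ballCone ((Complex.I * e) • (1 : A)), T c = S c + u := by
    intro e he h
    obtain ⟨S', u', h'⟩ := hcone (Complex.I * e) (by simp [he])
    have hI : ‖Complex.I - 1‖ < 2 := by
      rw [← abs_of_nonneg (norm_nonneg (Complex.I - 1)), ← abs_of_pos (two_pos (α := ℝ)),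
        ← sq_lt_sq, ← Complex.normSq_eq_norm_sq, Complex.normSq_apply]
      norm_num
    have h1 : ‖Complex.I * e - e‖ < 2 := by
      rw [← sub_one_mul, norm_mul, he, mul_one]
      exact hI
    obtain ⟨rfl, rfl⟩ := eq_of_eqOn_open_inter (isOpen_ballCone _) (isOpen_ballCone _) h h'
      (smul_one_add_smul_one_mem_ballCone h1)
      (by rw [add_comm]; exact smul_one_add_smul_one_mem_ballCone (by rwa [norm_sub_rev]))
    exact h'
  have hS1 := hrot 1 (by simp) hS
  have hS2 := hrot _ (by simp) hS1
  have hS3 := hrot _ (by simp) hS2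
  have hall : ∀ (f : A) (c : ℂ), 4 * ‖f‖ < ‖c‖ →
      c • (1 : A) + f ∈ unitsCarrier G ∧ T (c • (1 : A) + f) = S (c • (1 : A) + f) + u := by
    intro f c hfc
    have aux : ∀ e : ℂ, ‖e‖ = 1 → (∀ c ∈ ballCone (e • (1 : A)), T c = S c + u) → ∀ z : ℂ,
        e * z = c → |z.im| ≤ z.re →
        c • (1 : A) + f ∈ unitsCarrier G ∧ T (c • (1 : A) + f) = S (c • (1 : A) + f) + u := by
      rintro e he h z rfl hz
      have hm := smul_one_add_mem_ballCone (A := A) (f := f) he hz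
        (by rwa [norm_mul, he, one_mul] at hfc)
      exact ⟨ballCone_smul_one_subset_unitsCarrier hG he hm, h _ hm⟩
    rcases le_total |c.im| |c.re| with h | h
    · rcases le_total 0 c.re with h0 | h0
      · exact aux 1 (by simp) hS c (by simp) (by rwa [abs_of_nonneg h0] at h)
      · exact aux _ (by simp) hS2 (-c) (by linear_combination (-c) * Complex.I_mul_I)
          (by rw [abs_of_nonpos h0] at h; simpa using h)
    · rcases le_total 0 c.im with h0 | h0
      · exact aux _ (by simp) hS1 (-Complex.I * c)
          (by linear_combination (-c) * Complex.I_mul_I)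
          (by rw [abs_of_nonneg h0] at h; simpa using h)
      · exact aux _ (by simp) hS3 (Complex.I * c)
          (by linear_combination (c * (Complex.I * Complex.I - 1)) * Complex.I_mul_I)
          (by rw [abs_of_nonpos h0] at h; simpa using h)
  refine ⟨S, u, fun f hf => ?_⟩
  set y := S.symm (T f - u) with hy
  have hSy : S y = T f - u := by simp [hy]
  -- The distance `‖c‖` from `c • 1 + f` to `f` is preserved by `T`; pulled back by `S` it reads `‖c
  -- • 1 - (y - f)‖ = ‖c‖`.
  have hzero : y - f = 0 := by
    refine eq_zero_of_norm_sub_le (R := 4 * ‖f‖ + 1) (by positivity) fun c hc => le_of_eq ?_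
    obtain ⟨hm, hTc⟩ := hall f c (by linarith)
    have h1 := hT _ hm f hf
    rw [hTc, dist_eq_norm, dist_eq_norm, add_sub_cancel_right, norm_smul, norm_one, mul_one] at h1
    rw [← h1, ← S.norm_map]
    congr 1
    rw [map_sub, map_sub, hSy, map_add]
    abel
  rw [sub_eq_zero.1 hzero] at hSy
  rw [hSy, sub_add_cancel]

end Rigidity

/-! ### Semisimplicity and vanishing of the translation -/

section Semisimple

variable {A : Type*} [NormedCommRing A] [NormedAlgebra ℂ A] [CompleteSpace A]

theorem JacobsonSemisimple.eq_zero_of_forall_isUnit {R : Type*} [CommRing R]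
    (hR : JacobsonSemisimple R) {a : R} (h : ∀ x, IsUnit (a * x + 1)) : a = 0 := by
  have : a ∈ Ideal.jacobson (⊥ : Ideal R) := Ideal.mem_jacobson_bot.2 h
  rwa [Ideal.jacobson_bot, show Ring.jacobson R = ⊥ from hR, Ideal.mem_bot] at this

theorem JacobsonSemisimple.of_injective {R R' : Type*} [Ring R] [Ring R']
    (hR : JacobsonSemisimple R) (f : R' →+* R) [RingHomSurjective f]
    (hf : Function.Injective f) : JacobsonSemisimple R' := by
  refine (Submodule.eq_bot_iff _).2 fun x hx => ?_
  have h : f x ∈ Ring.jacobson R := Ring.le_comap_jacobson f hx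
  rw [show Ring.jacobson R = ⊥ from hR, Ideal.mem_bot] at h
  exact hf (by rw [h, map_zero])

/-- Characters separate the points of a semisimple commutative Banach algebra. -/
theorem JacobsonSemisimple.eq_of_forall_algHom (hA : JacobsonSemisimple A) {a a' : A}
    (h : ∀ φ : A →ₐ[ℂ] ℂ, φ a = φ a') : a = a' := by
  rw [← sub_eq_zero]
  refine hA.eq_zero_of_forall_isUnit fun x => ?_
  by_contra hx
  obtain ⟨f, hf⟩ := WeakDual.CharacterSpace.exists_apply_eq_zero hx
  have := h (WeakDual.CharacterSpace.toAlgHom f)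
  have h2 : f a = f a' := this
  simp [h2] at hf

end Semisimple

section Translation

variable {A B : Type*} [NormedCommRing A] [NormedAlgebra ℂ A] [CompleteSpace A]
    [NormedRing B] [NormedAlgebra ℂ B] [CompleteSpace B]

/-- As `f + v * g = (f * g⁻¹ + v) * g`, translation by `v * g` also preserves the group. Any `x` is
`(x + t) + (-t)` with both terms in the group, so `v * x + 1` is a unit and `v` lies in the radical.
-/
theorem eq_zero_of_forall_add_mem_unitsCarrier (hA : JacobsonSemisimple A) {G : Subgroup Aˣ}
    (hG : IsOpen (G : Set Aˣ)) {v : A} (hv : ∀ f ∈ unitsCarrier G, f + v ∈ unitsCarrier G) :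
    v = 0 := by
  have hmul : ∀ g ∈ unitsCarrier G, ∀ f ∈ unitsCarrier G, f + v * g ∈ unitsCarrier G := by
    rintro _ ⟨g, hg, rfl⟩ f hf
    have h1 : ((g⁻¹ : Aˣ) : A) ∈ unitsCarrier G := ⟨g⁻¹, inv_mem hg, rfl⟩
    have h2 := mul_mem_unitsCarrier (hv _ (mul_mem_unitsCarrier hf h1)) ⟨g, hg, rfl⟩
    rwa [add_mul, mul_assoc, Units.inv_mul, mul_one] at h2
  have hone : (1 : A) ∈ unitsCarrier G := ⟨1, one_mem G, rfl⟩
  refine hA.eq_zero_of_forall_isUnit fun x => ?_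
  obtain ⟨t, ht⟩ : ∃ t : ℝ, ‖x‖ < t := exists_gt _
  have ht0 : t ≠ 0 := ((norm_nonneg x).trans_lt ht).ne'
  have h1 : x + t • ((1 : ℂ) • (1 : A)) ∈ unitsCarrier G :=
    ballCone_smul_one_subset_unitsCarrier hG (by simp) (add_smul_mem_ballCone ht)
  have h2 : (-t : ℂ) • (1 : A) ∈ unitsCarrier G :=
    smul_mem_unitsCarrier hG (by simpa using ht0) hone
  have h3 := hmul _ h2 _ (hmul _ h1 _ hone)
  have e : 1 + v * (x + t • ((1 : ℂ) • (1 : A))) + v * ((-t : ℂ) • (1 : A)) = v * x + 1 := by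
    rw [one_smul, neg_smul, Complex.coe_smul]
    ring
  rw [e] at h3
  obtain ⟨g, -, hg⟩ := h3
  exact ⟨g, hg⟩

-- Doubling `S f + u` inside `Y` and halving the preimage shows that the group is invariant under
-- translation by `S⁻¹ u / 2`.
omit [CompleteSpace B] in
theorem translation_eq_zero (hA : JacobsonSemisimple A) {G : Subgroup Aˣ}
    (hG : IsOpen (G : Set Aˣ)) {Y : Set B} (hY : ∀ r : ℝ, r ≠ 0 → ∀ y ∈ Y, r • y ∈ Y)
    (S : A ≃ₗᵢ[ℝ] B) {u : B} (hm : ∀ f ∈ unitsCarrier G, S f + u ∈ Y)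
    (hs : ∀ y ∈ Y, ∃ f ∈ unitsCarrier G, S f + u = y) : u = 0 := by
  have hv : ∀ f ∈ unitsCarrier G, f + (1 / 2 : ℝ) • S.symm u ∈ unitsCarrier G := by
    intro f hf
    obtain ⟨g, hg, hgf⟩ := hs _ (hY 2 two_ne_zero _ (hm f hf))
    have h2 := smul_mem_unitsCarrier hG (c := ((1 / 2 : ℝ) : ℂ)) (by norm_num) hg
    rw [Complex.coe_smul] at h2
    have hg' : g = (2 : ℝ) • f + S.symm u := by
      apply S.injective
      rw [map_add, map_smul, S.apply_symm_apply]
      linear_combination (norm := module) hgf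
    rw [hg'] at h2
    convert h2 using 1
    module
  have h0 := eq_zero_of_forall_add_mem_unitsCarrier hA hG hv
  simpa using h0

end Translation

/-! ### Multiplicativity of the linear isometry -/

section Multiplicative

variable {A B : Type*}
    [NormedCommRing A] [NormedAlgebra ℂ A] [NormOneClass A] [CompleteSpace A]
    [NormedRing B] [NormedAlgebra ℂ B] [NormOneClass B] [CompleteSpace B]

theorem map_mul_mul_map_one_of_norm_map {l : ℂ →ₗ[ℝ] ℂ} (hl : ∀ z, ‖l z‖ = ‖z‖) (z w : ℂ) :
    l (z * w) * l 1 = l z * l w := by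
  let l₁ : ℂ →ₗᵢ[ℝ] ℂ := ⟨l, hl⟩
  obtain ⟨a, ha | ha⟩ := linear_isometry_complex (l₁.toLinearIsometryEquiv rfl)
  · have h : ∀ z, l z = a * z := fun z => by
      rw [← rotation_apply, ← ha]; rfl
    simp only [h]
    ring
  · have h : ∀ z, l z = a * (starRingEnd ℂ) z := fun z => by
      have := DFunLike.congr_fun ha z
      exact this.trans (by simp)
    simp only [h, map_mul, map_one]
    ring

/-- In `φ ∘ S⁻¹ = l ∘ χ`, contractivity of `φ` bounds `l` and contractivity of `χ` bounds its
inverse. So `l` is an isometry, multiplicative up to `l 1`, and `l (χ (S 1)) = 1` removes the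
factor. -/
theorem algHom_symm_map_one_mul (S : A ≃ₗᵢ[ℝ] B) (hS : ∀ b : B, IsUnit (S.symm (exp b)))
    (φ : A →ₐ[ℂ] ℂ) (b b' : B) :
    φ (S.symm (S 1 * (b * b'))) = φ (S.symm (S 1 * b)) * φ (S.symm (S 1 * b')) := by
  let ψ : B →L[ℝ] ℂ := ((AlgHom.toContinuousLinearMap φ).restrictScalars ℝ).comp
    (S.symm.toContinuousLinearEquiv : B →L[ℝ] A)
  obtain ⟨χ, l, hl⟩ := exists_algHom_comp_of_forall_map_exp_ne_zero ψ
    (fun b => ((hS b).map φ).ne_zero)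
  have hφl : ∀ b, φ (S.symm b) = l (χ b) := hl
  have hle : ∀ z, ‖l z‖ ≤ ‖z‖ := by
    intro z
    have h1 := hφl (algebraMap ℂ B z)
    rw [AlgHom.commutes, Algebra.algebraMap_self, RingHom.id_apply] at h1
    rw [← h1]
    refine (AlgHom.norm_apply_le_self φ _).trans ?_
    rw [S.symm.norm_map, norm_algebraMap']
  have hright : ∀ z, l (χ (S (algebraMap ℂ A z))) = z := by
    intro z
    rw [← hφl, S.symm_apply_apply, AlgHom.commutes, Algebra.algebraMap_self, RingHom.id_apply]
  have hinj : Function.Injective l :=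
    LinearMap.injective_iff_surjective.2 fun z => ⟨_, hright z⟩
  have hnorm : ∀ z, ‖l z‖ = ‖z‖ := by
    intro z
    refine le_antisymm (hle z) ?_
    have h1 : χ (S (algebraMap ℂ A (l z))) = z := hinj (hright (l z))
    calc ‖z‖ = ‖χ (S (algebraMap ℂ A (l z)))‖ := by rw [h1]
      _ ≤ ‖S (algebraMap ℂ A (l z))‖ := AlgHom.norm_apply_le_self χ _
      _ = ‖l z‖ := by rw [S.norm_map, norm_algebraMap']
  have hmul := map_mul_mul_map_one_of_norm_map hnorm
  have hw : l (χ (S 1)) = 1 := by rw [← hφl, S.symm_apply_apply, map_one]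
  have hl1 : l 1 ≠ 0 := by
    rw [← norm_ne_zero_iff, hnorm]; simp
  have key : ∀ b, φ (S.symm (S 1 * b)) * l 1 = l (χ b) := fun b => by
    rw [hφl, map_mul, hmul, hw, one_mul]
  have h := hmul (χ b) (χ b')
  rw [← map_mul χ, ← key, ← key b, ← key b'] at h
  have h2 : l 1 * l 1 ≠ 0 := mul_ne_zero hl1 hl1
  exact mul_right_cancel₀ h2 (by linear_combination h)

/-- A real linear isometry onto `B` whose inverse maps exponentials to units is, up to a unit,
an isometric isomorphism of real algebras. -/
theorem exists_algEquiv_of_isUnit_symm_exp (hA : JacobsonSemisimple A) (S : A ≃ₗᵢ[ℝ] B)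
    (hS : ∀ b : B, IsUnit (S.symm (exp b))) (h1 : IsUnit (S 1)) :
    ∃ Φ : A ≃ₐ[ℝ] B, Isometry Φ ∧ ∀ a, S 1 * Φ a = S a := by
  let p : B →ₗ[ℝ] A := (S.symm.toLinearEquiv : B →ₗ[ℝ] A) ∘ₗ LinearMap.mulLeft ℝ (S 1)
  have hp : ∀ b, p b = S.symm (S 1 * b) := fun _ => rfl
  let P : B →ₐ[ℝ] A := AlgHom.ofLinearMap p (by simp [hp]) fun b b' =>
    hA.eq_of_forall_algHom fun φ => by
      rw [map_mul φ]
      exact algHom_symm_map_one_mul S hS φ b b'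
  have hP : ∀ b, S (P b) = S 1 * b := fun b => S.apply_symm_apply _
  have hbij : Function.Bijective P := by
    refine ⟨fun b b' h => ?_, fun a => ?_⟩
    · have h2 := congrArg S h
      rw [hP, hP] at h2
      exact h1.mul_left_cancel h2
    · obtain ⟨w, hw⟩ := h1
      refine ⟨(w⁻¹ : Bˣ) * S a, S.injective ?_⟩
      rw [hP, ← hw, Units.mul_inv_cancel_left]
  let e : B ≃ₐ[ℝ] A := AlgEquiv.ofBijective P hbij
  have he : ∀ a, S 1 * e.symm a = S a := fun a => by
    rw [← hP]
    exact congrArg S (e.apply_symm_apply a)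
  refine ⟨e.symm, AddMonoidHomClass.isometry_of_norm _ fun a => le_antisymm ?_ ?_, he⟩
  · obtain ⟨w, hw⟩ := h1
    -- `‖w⁻¹‖` is not known to be `1`, but its image under `e` is `S⁻¹ 1`, of norm `1`; multiplying
    -- by that in `A` gives the upper bound.
    have hx : S (e ((w⁻¹ : Bˣ) : B)) = 1 := by
      rw [show e ((w⁻¹ : Bˣ) : B) = P ((w⁻¹ : Bˣ) : B) from rfl, hP, ← hw, Units.mul_inv]
    have hn : ‖e ((w⁻¹ : Bˣ) : B)‖ = 1 := by rw [← S.norm_map, hx, norm_one]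
    have hy : e.symm a = S (e ((w⁻¹ : Bˣ) : B) * a) := by
      rw [← he, map_mul, e.symm_apply_apply, ← hw, Units.mul_inv_cancel_left]
    calc ‖e.symm a‖ = ‖e ((w⁻¹ : Bˣ) : B) * a‖ := by rw [hy, S.norm_map]
      _ ≤ ‖e ((w⁻¹ : Bˣ) : B)‖ * ‖a‖ := norm_mul_le _ _
      _ = ‖a‖ := by rw [hn, one_mul]
  · calc ‖a‖ = ‖S 1 * e.symm a‖ := by rw [he, S.norm_map]
      _ ≤ ‖S 1‖ * ‖e.symm a‖ := norm_mul_le _ _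
      _ = ‖e.symm a‖ := by rw [S.norm_map, norm_one, one_mul]

end Multiplicative

/-! ### Assembly -/

theorem mainTheorem1 {A B : Type*}
    [NormedCommRing A] [NormedAlgebra ℂ A] [NormOneClass A] [CompleteSpace A]
    [NormedRing B] [NormedAlgebra ℂ B] [NormOneClass B] [CompleteSpace B]
    (hA : JacobsonSemisimple A)
    (GA : Subgroup Aˣ) (hGA : IsOpen (GA : Set Aˣ))
    (GB : Subgroup Bˣ) (hGB : IsOpen (GB : Set Bˣ))
    (T : GA → GB) (hTsurj : Function.Surjective T)
    (hTisom : ∀ f g : GA, dist ((T f : Bˣ) : B) ((T g : Bˣ) : B) =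
      dist ((f : Aˣ) : A) ((g : Aˣ) : A)) :
    JacobsonSemisimple B ∧
    (∀ a b : B, a * b = b * a) ∧
    (∃ Φ : A ≃ₐ[ℝ] B, Isometry Φ ∧
      ∀ f : GA, Φ ((f : Aˣ) : A) = (((T 1)⁻¹ * T f : GB) : Bˣ)) ∧
    (∃ Ψ : Aˣ ≃* Bˣ, ∀ u v : Aˣ, dist (Ψ u : B) (Ψ v : B) = dist (u : A) (v : A)) := by
  let ι : GA → A := fun f => ((f : Aˣ) : A)
  have hι : Function.Injective ι := Units.val_injective.comp Subtype.val_injective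
  -- The value `0` off the group is never used.
  let T' : A → B := Function.extend ι (fun f => ((T f : Bˣ) : B)) 0
  have hT' : ∀ f : GA, T' ((f : Aˣ) : A) = ((T f : Bˣ) : B) := fun f => hι.extend_apply _ _ f
  have hmem : ∀ f : GA, ((f : Aˣ) : A) ∈ unitsCarrier GA := fun f => ⟨f, f.2, rfl⟩
  have hmaps : MapsTo T' (unitsCarrier GA) (unitsCarrier GB) := by
    rintro _ ⟨f, hf, rfl⟩
    rw [hT' ⟨f, hf⟩]
    exact ⟨_, (T ⟨f, hf⟩).2, rfl⟩
  have hsurj : SurjOn T' (unitsCarrier GA) (unitsCarrier GB) := by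
    rintro _ ⟨g, hg, rfl⟩
    obtain ⟨f, hf⟩ := hTsurj ⟨g, hg⟩
    exact ⟨_, hmem f, by rw [hT' f, hf]⟩
  have hisom : ∀ x ∈ unitsCarrier GA, ∀ y ∈ unitsCarrier GA, dist (T' x) (T' y) = dist x y := by
    rintro _ ⟨f, hf, rfl⟩ _ ⟨g, hg, rfl⟩
    rw [hT' ⟨f, hf⟩, hT' ⟨g, hg⟩, hTisom]
  obtain ⟨S, u, hS⟩ := exists_linearIsometryEquiv_of_unitsCarrier hGA (isOpen_unitsCarrier hGB)
    hmaps hsurj hisom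
  obtain rfl : u = 0 := by
    refine translation_eq_zero hA hGA (Y := unitsCarrier GB) (fun r hr y hy => ?_) S
      (fun f hf => hS f hf ▸ hmaps hf) (fun y hy => ?_)
    · rw [← Complex.coe_smul]
      exact smul_mem_unitsCarrier hGB (by exact_mod_cast hr) hy
    · obtain ⟨f, hf, rfl⟩ := hsurj hy
      exact ⟨f, hf, (hS f hf).symm⟩
  have hST : ∀ f : GA, S ((f : Aˣ) : A) = ((T f : Bˣ) : B) := fun f => by
    rw [← hT', hS _ (hmem f), add_zero]
  have hS1 : S 1 = ((T 1 : Bˣ) : B) := hST 1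
  -- Exponentials lie in `GB`, so each is some `T f = S f`, and `S⁻¹` returns the unit `f`.
  obtain ⟨Φ, hΦ, hSΦ⟩ := exists_algEquiv_of_isUnit_symm_exp hA S (fun b => by
    obtain ⟨_, ⟨f, hf, rfl⟩, hfb⟩ := hsurj (exp_mem_unitsCarrier hGB b)
    rw [← hfb, hS _ ⟨f, hf, rfl⟩, add_zero, S.symm_apply_apply]
    exact f.isUnit) (hS1 ▸ (T 1 : Bˣ).isUnit)
  refine ⟨?_, fun a b => ?_, ⟨Φ, hΦ, fun f => ?_⟩, ⟨Units.mapEquiv Φ.toMulEquiv, fun u v => ?_⟩⟩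
  · exact hA.of_injective (Φ.symm.toRingEquiv : B →+* A) Φ.symm.injective
  · apply Φ.symm.injective
    rw [map_mul, map_mul, mul_comm]
  · have h := hSΦ ((f : Aˣ) : A)
    rw [hST, hS1] at h
    rw [Subgroup.coe_mul, Subgroup.coe_inv, Units.val_mul, ← h, Units.inv_mul_cancel_left]
  · exact hΦ.dist_eq _ _
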